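/- Let $\mathbb T$ be the unit circle with normalized arclength measure $\mu$, let $\chi(z)=z$ on $\mathbb T$, and let $H^2\subset L^2(\mathbb T)$ be the classical Hardy space (the functions whose Fourier coefficients of negative index vanish). Let $\phi\in L^\infty(\mathbb T)$ be real-valued. For a linear subspace $\mathcal V\subset\mathbb C\oplus\mathbb C z$ put $H^2_{\mathcal V}=H^2\ominus\mathcal V$, let $P_{\mathcal V}$ be the orthogonal projection of $L^2(\mathbb T)$ onto $H^2_{\mathcal V}$, and define the Toeplitz operator $T_\phi^{\mathcal V}f=P_{\mathcal V}(\phi f)$ on $H^2_{\mathcal V}$. A real number $\lambda$ is an eigenvalue of $\phi$ relative to the Neil algebra $\mathcal A$ (the functions $f$ in the disc algebra with $f'(0)=0$), with eigenvector $g$, if there is a subspace $\mathcal V\subset\mathbb C\oplus\mathbb C z$ such that $0\ne g\in H^2_{\mathcal V}$ and $T_\phi^{\mathcal V}g=\lambda g$. A function $g\in H^2$ is outer if $\{pg: p \text{ a polynomial in } z\}$ is dense in $H^2$. Suppose that there are $c\in\mathbb C$ and real numbers $m,M$ such that \[ \operatorname{ess\,sup}\{\phi(z): cz+(cz)^*<0\}=m<0<M=\operatorname{ess\,inf}\{\phi(z):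 cz+(cz)^*>0\}. \] Then: 1. Each $\lambda\in(m,M)$ is an eigenvalue of $\phi$ relative to $\mathcal A$. Further, for each such $\lambda$ there is an outer function $f_\lambda\in H^2$, unique up to multiplication by a unimodular constant, such that \[ (\phi-\lambda)|f_\lambda|^2=c\chi+(c\chi)^*\quad\text{a.e. on }\mathbb T \] (with the given $c$, independent of $\lambda$), and $f_\lambda$ is an eigenvector of $\phi$ relative to $\mathcal A$ for the eigenvalue $\lambda$. 2. $M$ is an eigenvalue of $\phi$ relative to $\mathcal A$ if and only if $\dfrac{c\chi+(c\chi)^*}{\phi-M}\in L^1(\mathbb T)$, and $m$ is an eigenvalue of $\phi$ relative to $\mathcal A$ if and only if $\dfrac{c\chi+(c\chi)^*}{\phi-m}\in L^1(\mathbb T)$. Here a quotient counts as being in $L^1$ only if its denominator is nonzero almost everywhere. -/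

import Mathlib

open MeasureTheory AddCircle

noncomputable section

namespace NeilToeplitz

instance instTwoPiPos : Fact (0 < 2 * Real.pi) := ⟨Real.two_pi_pos⟩

/-- The unit circle `𝕋`, parametrised by the angle `t` through `t ↦ e^{it}`.  The function
`χ(z) = z` on `𝕋` is Mathlib's `fourier 1`, and `χ ^ n` is `fourier n`. -/
abbrev Circ : Type := AddCircle (2 * Real.pi)

/-- Normalised arclength measure on `𝕋`. -/
abbrev arc : Measure Circ := haarAddCircle

/-- The complex Hilbert space `L²(𝕋)`. -/
abbrev L2 : Type := Lp ℂ 2 arc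

/-- The real-valued symbols: the real space `L^∞(𝕋)`. -/
abbrev Symbol : Type := Lp ℝ ⊤ arc

theorem fourierCoeff_eq_inner (f : L2) (n : ℤ) :
    fourierCoeff (f : Circ → ℂ) n = inner ℂ (fourierLp (T := 2 * Real.pi) 2 n) f := by
  rw [← fourierBasis_repr, HilbertBasis.repr_apply_apply, coe_fourierBasis]

/-- The Hardy space `H²`, as the space of boundary functions: those `f ∈ L²(𝕋)` whose Fourier
coefficients of negative index vanish. -/
def hardy : Submodule ℂ L2 where
  carrier := {f | ∀ n : ℤ, n < 0 → fourierCoeff (f : Circ → ℂ) n = 0}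
  zero_mem' := fun n _ => by rw [fourierCoeff_eq_inner, inner_zero_right]
  add_mem' := fun {f g} hf hg n hn => by
    rw [fourierCoeff_eq_inner, inner_add_right, ← fourierCoeff_eq_inner,
      ← fourierCoeff_eq_inner, hf n hn, hg n hn, add_zero]
  smul_mem' := fun a f hf n hn => by
    rw [fourierCoeff_eq_inner, inner_smul_right, ← fourierCoeff_eq_inner, hf n hn, mul_zero]

theorem mem_hardy {f : L2} :
    f ∈ hardy ↔ ∀ n : ℤ, n < 0 → fourierCoeff (f : Circ → ℂ) n = 0 := Iff.rfl

theorem isClosed_hardy : IsClosed (hardy : Set L2) := by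
  have h : (hardy : Set L2) =
      ⋂ n : ℤ, ⋂ _ : n < 0, {f : L2 | inner ℂ (fourierLp (T := 2 * Real.pi) 2 n) f = 0} := by
    ext f
    simp only [SetLike.mem_coe, mem_hardy, fourierCoeff_eq_inner, Set.mem_iInter,
      Set.mem_ofPred_eq]
  rw [h]
  exact isClosed_iInter fun n => isClosed_iInter fun _ =>
    isClosed_eq (continuous_const.inner continuous_id) continuous_const

/-- The two-dimensional space `ℂ ⊕ ℂ z ⊆ H²`. -/
def lowDegree : Submodule ℂ L2 :=
  Submodule.span ℂ {fourierLp (T := 2 * Real.pi) 2 0, fourierLp (T := 2 * Real.pi) 2 1}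

/-- `H²_𝒱 = H² ⊖ 𝒱`. -/
def hardySub (V : Submodule ℂ L2) : Submodule ℂ L2 := hardy ⊓ Vᗮ

theorem isClosed_hardySub (V : Submodule ℂ L2) : IsClosed (hardySub V : Set L2) :=
  isClosed_hardy.inter V.isClosed_orthogonal

instance (V : Submodule ℂ L2) : CompleteSpace (hardySub V) :=
  (isClosed_hardySub V).completeSpace_coe

/-- The bounded operator `f ↦ φ f` on `L²(𝕋)`, for a real symbol `φ ∈ L^∞(𝕋)`. -/
def mulSymbol (φ : Symbol) : L2 →L[ℂ] L2 :=
  LinearMap.mkContinuous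
    { toFun := fun f => (φ • f : L2)
      map_add' := fun f g => Lp.add_smul φ f g
      map_smul' := fun a f => by
        refine Lp.ext ?_
        filter_upwards [Lp.coeFn_lpSMul (r := 2) φ (a • f), Lp.coeFn_smul a f,
          Lp.coeFn_lpSMul (r := 2) φ f, Lp.coeFn_smul a (φ • f : L2)] with x h1 h2 h3 h4
        rw [h1, RingHom.id_apply, h4, Pi.smul_apply', h2, Pi.smul_apply, Pi.smul_apply, h3,
          Pi.smul_apply', smul_comm] }
    ‖φ‖ (fun f => Lp.norm_smul_le φ f)

/-- `mulSymbol φ` is pointwise multiplication by `φ`. -/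
theorem mulSymbol_coe (φ : Symbol) (f : L2) :
    (mulSymbol φ f : Circ → ℂ) =ᵐ[arc] fun x => (φ x : ℂ) * f x := by
  filter_upwards [Lp.coeFn_lpSMul (r := 2) φ f] with x hx
  exact hx

/-- The Toeplitz operator `T_φ^𝒱 f = P_𝒱 (φ f)` on `H²_𝒱`, where `P_𝒱` is the orthogonal
projection of `L²(𝕋)` onto `H²_𝒱`. -/
def toeplitz (φ : Symbol) (V : Submodule ℂ L2) : hardySub V →L[ℂ] hardySub V :=
  (hardySub V).orthogonalProjectionOnto ∘L mulSymbol φ ∘L (hardySub V).subtypeL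

/-- `g` is an eigenvector for the eigenvalue `lam` of `φ` relative to the Neil algebra:
for some `𝒱 ⊆ ℂ ⊕ ℂ z`, `g` is a nonzero element of `H²_𝒱` and `T_φ^𝒱 g = lam g`. -/
def IsNeilEigenvector (φ : Symbol) (lam : ℝ) (g : L2) : Prop :=
  ∃ V : Submodule ℂ L2, V ≤ lowDegree ∧ ∃ hg : g ∈ hardySub V,
    g ≠ 0 ∧ toeplitz φ V ⟨g, hg⟩ = (lam : ℂ) • (⟨g, hg⟩ : hardySub V)

/-- `lam` is an eigenvalue of `φ` relative to the Neil algebra. -/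
def IsNeilEigenvalue (φ : Symbol) (lam : ℝ) : Prop :=
  ∃ g : L2, IsNeilEigenvector φ lam g

/-- `g` is an outer function of `H²`: the set of all `p g`, with `p` a polynomial in `z`, is dense
in `H²` (in particular `g ∈ H²`). -/
def IsOuter (g : L2) : Prop :=
  (Submodule.span ℂ (Set.range fun n : ℕ =>
    (fourierLp (T := 2 * Real.pi) ⊤ (n : ℤ) • g : L2))).topologicalClosure = hardy

/-- The real-valued function `cχ + (cχ)^*` on `𝕋`. -/
def trig (c : ℂ) (x : Circ) : ℝ :=
  (c * fourier 1 x + (starRingEnd ℂ) (c * fourier 1 x)).re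

theorem trig_coe (c : ℂ) (x : Circ) :
    (trig c x : ℂ) = c * fourier 1 x + (starRingEnd ℂ) (c * fourier 1 x) := by
  rw [trig, Complex.add_conj, Complex.ofReal_re]

/-- The quotient `u / v` defines an element of `L¹(𝕋)`.  The denominator must be nonzero almost
everywhere, as `x / 0 = 0` in Lean would otherwise hide an infinite quotient. -/
def QuotientMemL1 (u v : Circ → ℝ) : Prop :=
  (∀ᵐ x ∂arc, v x ≠ 0) ∧ Integrable (fun x => u x / v x) arc

end NeilToeplitz

end

/-!
For an eigenvector `g` with eigenvalue `λ`, the function `(φ - λ)g` is orthogonal to `g` and to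
`zⁿg` for `n ≥ 2`, since these lie in `H²_𝒱`.  Hence the real function `(φ - λ)|g|²` has no Fourier
coefficients outside `±1`, so it equals `dχ + (dχ)^*` for some `d`; comparing signs, `d` is a
nonnegative multiple of `c`, which gives the integrability condition at the endpoints.

Conversely, if `w = (cχ + (cχ)^*) / (φ - λ) ≥ 0` is integrable, as it is for `λ` in the open gap,
then `w = |f|²` with `f` outer, and `f` is an eigenvector for `𝒱 = (ℂ ⊕ ℂz) ⊖ ℂf`, because
`H²_𝒱 = ℂf + z²H²`.  The outer function comes from Beurling's argument: let `k = √w` and write `[k]`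
for the closure of `{p k : p a polynomial}`; a unit vector of `[k] ⊖ z[k]` is a unimodular function
`e`, and `f = ē k`.  That `[k] ≠ z[k]` is where boundedness of `φ` enters: `w` dominates a multiple
of `|cχ + (cχ)^*|²`, the squared modulus of the polynomial `cz² + c^*`, and no nonzero `h ∈ H²` lies
in `z[h]`.
-/

noncomputable section

namespace NeilToeplitz

open Filter Topology ComplexConjugate
open scoped ENNReal NNReal BoundedContinuousFunction

section FourierUniqueness

theorem ae_eq_zero_of_forall_integral_smul_eq_zero {X E : Type*} [TopologicalSpace X]
    [MeasurableSpace X] [BorelSpace X] [HasOuterApproxClosed X] [NormedAddCommGroup E]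
    [NormedSpace ℝ E] [CompleteSpace E] {μ : Measure X} {F : X → E} (hF : Integrable F μ)
    (h : ∀ g : X →ᵇ ℝ≥0, ∫ x, (g x : ℝ) • F x ∂μ = 0) : F =ᵐ[μ] 0 := by
  refine ae_eq_zero_of_forall_setIntegral_isClosed_eq_zero hF fun K hK => ?_
  rw [← integral_indicator hK.measurableSet]
  have hlim : Tendsto (fun n => ∫ x, (hK.apprSeq n x : ℝ) • F x ∂μ) atTop
      (𝓝 (∫ x, K.indicator F x ∂μ)) := by
    refine tendsto_integral_of_dominated_convergence (fun x => ‖F x‖) (fun n => ?_) hF.norm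
      (fun n => .of_forall fun x => ?_) (.of_forall fun x => ?_)
    · exact (NNReal.continuous_coe.comp
        (hK.apprSeq n).continuous).measurable.aestronglyMeasurable.smul hF.1
    · rw [norm_smul, NNReal.norm_eq]
      exact mul_le_of_le_one_left (norm_nonneg _)
        (mod_cast HasOuterApproxClosed.apprSeq_apply_le_one hK n x)
    · have happr := (NNReal.continuous_coe.tendsto _).comp
        (tendsto_pi_nhds.1 (HasOuterApproxClosed.tendsto_apprSeq hK) x)
      by_cases hx : x ∈ K <;> simpa [hx] using happr.smul_const (F x)
  exact tendsto_nhds_unique hlim (by simp only [h, tendsto_const_nhds])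

variable {T : ℝ} [Fact (0 < T)]

section

variable {E : Type*} [NormedAddCommGroup E] [NormedSpace ℂ E]

theorem integral_smul_eq_zero_of_fourierCoeff_eq_zero {F : AddCircle T → E}
    (hF : Integrable F haarAddCircle) (h0 : ∀ n, fourierCoeff F n = 0) (g : C(AddCircle T, ℂ)) :
    ∫ x, g x • F x ∂haarAddCircle = 0 := by
  have hint (g : C(AddCircle T, ℂ)) : Integrable (fun x => g x • F x) haarAddCircle :=
    hF.bdd_smul ‖g‖ g.continuous.aestronglyMeasurable (.of_forall g.norm_coe_le_norm)
  let Λ : C(AddCircle T, ℂ) →L[ℂ] E := LinearMap.mkContinuous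
    { toFun := fun g => ∫ x, g x • F x ∂haarAddCircle
      map_add' := fun g h => by
        simp only [ContinuousMap.add_apply, add_smul, integral_add (hint g) (hint h)]
      map_smul' := fun a g => by
        simp only [ContinuousMap.smul_apply, smul_assoc, integral_smul, RingHom.id_apply] }
    (∫ x, ‖F x‖ ∂haarAddCircle) fun g => by
      rw [mul_comm, ← integral_const_mul]
      refine norm_integral_le_of_norm_le (hF.norm.const_mul _) (.of_forall fun x => ?_)
      rw [norm_smul]
      gcongr
      exact g.norm_coe_le_norm x
  have hle : (Submodule.span ℂ (Set.range (@fourier T))).topologicalClosure ≤ Λ.ker := by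
    refine Submodule.topologicalClosure_minimal _ (Submodule.span_le.2 ?_) Λ.isClosed_ker
    rintro _ ⟨n, rfl⟩
    have hn := h0 (-n)
    rwa [fourierCoeff, neg_neg] at hn
  rw [span_fourier_closure_eq_top] at hle
  exact hle (Submodule.mem_top : g ∈ ⊤)

theorem ae_eq_of_fourierCoeff_eq [CompleteSpace E] {F G : AddCircle T → E}
    (hF : Integrable F haarAddCircle) (hG : Integrable G haarAddCircle)
    (h : ∀ n, fourierCoeff F n = fourierCoeff G n) : F =ᵐ[haarAddCircle] G := by
  have hsub (n : ℤ) : fourierCoeff (F - G) n = 0 := by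
    rw [← sub_eq_zero.2 (h n)]
    simp only [fourierCoeff, Pi.sub_apply, smul_sub]
    exact integral_sub (hF.fourier_smul _) (hG.fourier_smul _)
  have hzero := ae_eq_zero_of_forall_integral_smul_eq_zero (hF.sub hG) fun g =>
    integral_smul_eq_zero_of_fourierCoeff_eq_zero (hF.sub hG) hsub
      ⟨fun x => ((g x : ℝ) : ℂ), by fun_prop⟩
  exact hzero.mono fun x hx => sub_eq_zero.1 hx

end

theorem fourierCoeff_const (c : ℂ) (n : ℤ) :
    fourierCoeff (fun _ : AddCircle T => c) n = if n = 0 then c else 0 := by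
  simpa [fourierCoeff_fourier, Pi.single_apply] using
    fourierCoeff.const_mul (fourier 0 : AddCircle T → ℂ) c n

theorem fourierCoeff_conj (F : AddCircle T → ℂ) (n : ℤ) :
    fourierCoeff (fun x => conj (F x)) n = conj (fourierCoeff F (-n)) := by
  simp only [fourierCoeff, ← integral_conj, smul_eq_mul, map_mul, ← fourier_neg, neg_neg]

theorem ae_eq_of_fourierCoeff_natCast_eq {F G : AddCircle T → ℝ}
    (hF : Integrable F haarAddCircle) (hG : Integrable G haarAddCircle)
    (h : ∀ n : ℕ, fourierCoeff (fun x => (F x : ℂ)) n = fourierCoeff (fun x => (G x : ℂ)) n) :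
    F =ᵐ[haarAddCircle] G := by
  have hneg (F : AddCircle T → ℝ) (n : ℤ) :
      fourierCoeff (fun x => (F x : ℂ)) (-n) = conj (fourierCoeff (fun x => (F x : ℂ)) n) := by
    simpa using fourierCoeff_conj (fun x => (F x : ℂ)) (-n)
  have hall (n : ℤ) :
      fourierCoeff (fun x => (F x : ℂ)) n = fourierCoeff (fun x => (G x : ℂ)) n := by
    obtain ⟨j, rfl | rfl⟩ := n.eq_nat_or_neg
    · exact h j
    · rw [hneg, hneg, h]
  filter_upwards [ae_eq_of_fourierCoeff_eq hF.ofReal hG.ofReal hall] with x hx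
  exact Complex.ofReal_injective hx

end FourierUniqueness

section Multiplication

variable {α : Type*} [MeasurableSpace α] {μ : Measure α}

theorem inner_eq_integral (f g : Lp ℂ 2 μ) : inner ℂ f g = ∫ x, conj (f x) * g x ∂μ := by
  simp only [L2.inner_def, RCLike.inner_apply']

theorem integrable_norm_sq (f : Lp ℂ 2 μ) : Integrable (fun x => ‖f x‖ ^ 2) μ :=
  (memLp_two_iff_integrable_sq_norm (Lp.aestronglyMeasurable f)).1 (Lp.memLp f)

/-- Multiplication by `a ∈ L^∞(μ)`, as a bounded operator on `L²(μ)`. -/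
def mulOp (a : Lp ℂ ∞ μ) : Lp ℂ 2 μ →L[ℂ] Lp ℂ 2 μ :=
  (ContinuousLinearMap.mul ℂ ℂ).holderL μ ∞ 2 2 a

theorem coeFn_mulOp (a : Lp ℂ ∞ μ) (f : Lp ℂ 2 μ) : mulOp a f =ᵐ[μ] fun x => a x * f x :=
  (ContinuousLinearMap.mul ℂ ℂ).coeFn_holder a f

theorem mulOp_comm (a b : Lp ℂ ∞ μ) (f : Lp ℂ 2 μ) :
    mulOp a (mulOp b f) = mulOp b (mulOp a f) := by
  refine Lp.ext ?_
  filter_upwards [coeFn_mulOp a (mulOp b f), coeFn_mulOp b f, coeFn_mulOp b (mulOp a f),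
    coeFn_mulOp a f] with x hab hb hba ha
  rw [hab, hb, hba, ha, mul_left_comm]

theorem exists_mulOp_eq_of_norm_le {h k : Lp ℂ 2 μ} {C : ℝ}
    (hC : ∀ᵐ x ∂μ, ‖h x‖ ≤ C * ‖k x‖) :
    ∃ a : Lp ℂ ∞ μ, mulOp a k = h ∧ a =ᵐ[μ] fun x => h x / k x := by
  have hbound : ∀ᵐ x ∂μ, ‖h x / k x‖ ≤ |C| := hC.mono fun x hx => by
    rw [norm_div]
    exact div_le_of_le_mul₀ (norm_nonneg _) (abs_nonneg C)
      (hx.trans (mul_le_mul_of_nonneg_right (le_abs_self C) (norm_nonneg _)))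
  have hmeas : AEStronglyMeasurable (fun x => h x / k x) μ :=
    (Lp.aestronglyMeasurable h).div₀ (Lp.aestronglyMeasurable k)
  have hcoe := (memLp_top_of_bound hmeas |C| hbound).coeFn_toLp
  refine ⟨_, Lp.ext ?_, hcoe⟩
  filter_upwards [coeFn_mulOp _ k, hcoe, hC] with x hmul hx hle
  rw [hmul, hx]
  refine div_mul_cancel_of_imp fun h0 => ?_
  simpa [h0] using hle

theorem ae_le_of_essSup_restrict_eq {f : α → ℝ} {s : Set α} (hs : MeasurableSet s) {m : ℝ}
    (h : essSup (fun x => (f x : EReal)) (μ.restrict s) = m) : ∀ᵐ x ∂μ, x ∈ s → f x ≤ m := by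
  rw [← ae_restrict_iff' hs]
  filter_upwards [ae_le_essSup (f := fun x => (f x : EReal))] with x hx
  exact EReal.coe_le_coe_iff.1 (h ▸ hx)

theorem ae_le_of_essInf_restrict_eq {f : α → ℝ} {s : Set α} (hs : MeasurableSet s) {m : ℝ}
    (h : essInf (fun x => (f x : EReal)) (μ.restrict s) = m) : ∀ᵐ x ∂μ, x ∈ s → m ≤ f x := by
  rw [← ae_restrict_iff' hs]
  filter_upwards [ae_essInf_le (f := fun x => (f x : EReal))] with x hx
  exact EReal.coe_le_coe_iff.1 (h ▸ hx)

end Multiplication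

section Shift

/-- Multiplication by `χ ^ n` on `L²(𝕋)`. -/
def shift (n : ℤ) : L2 →L[ℂ] L2 := mulOp (fourierLp ∞ n)

theorem coeFn_shift (n : ℤ) (f : L2) : shift n f =ᵐ[arc] fun x => fourier n x * f x := by
  filter_upwards [coeFn_mulOp (fourierLp ∞ n) f, coeFn_fourierLp ∞ n] with x hmul hn
  rw [shift, hmul, hn]

theorem shift_shift (m n : ℤ) (f : L2) : shift m (shift n f) = shift (m + n) f := by
  refine Lp.ext ?_
  filter_upwards [coeFn_shift m (shift n f), coeFn_shift n f, coeFn_shift (m + n) f]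
    with x hm hn hmn
  rw [hm, hn, hmn, fourier_add, mul_assoc]

theorem shift_zero (f : L2) : shift 0 f = f := by
  refine Lp.ext ?_
  filter_upwards [coeFn_shift 0 f] with x hx
  rw [hx, fourier_zero, one_mul]

theorem inner_shift (n : ℤ) (f g : L2) : inner ℂ f (shift n g) = inner ℂ (shift (-n) f) g := by
  rw [inner_eq_integral, inner_eq_integral]
  refine integral_congr_ae ?_
  filter_upwards [coeFn_shift n g, coeFn_shift (-n) f] with x hg hf
  rw [hg, hf, map_mul, fourier_neg, Complex.conj_conj]
  ring

theorem shift_fourierLp (m n : ℤ) : shift m (fourierLp 2 n) = fourierLp 2 (m + n) := by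
  refine Lp.ext ?_
  filter_upwards [coeFn_shift m (fourierLp 2 n), coeFn_fourierLp (T := 2 * Real.pi) 2 n,
    coeFn_fourierLp (T := 2 * Real.pi) 2 (m + n)] with x hm hn hmn
  rw [hm, hn, hmn, fourier_add]

theorem fourierCoeff_shift (m n : ℤ) (f : L2) :
    fourierCoeff (shift m f : Circ → ℂ) n = fourierCoeff (f : Circ → ℂ) (n - m) := by
  rw [fourierCoeff_eq_inner, fourierCoeff_eq_inner, inner_shift, shift_fourierLp, neg_add_eq_sub]

theorem fourierCoeff_zero (n : ℤ) : fourierCoeff ((0 : L2) : Circ → ℂ) n = 0 := by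
  rw [fourierCoeff_eq_inner, inner_zero_right]

theorem fourierCoeff_sub (f g : L2) (n : ℤ) :
    fourierCoeff ((f - g : L2) : Circ → ℂ) n
      = fourierCoeff (f : Circ → ℂ) n - fourierCoeff (g : Circ → ℂ) n := by
  simp only [fourierCoeff_eq_inner, inner_sub_right]

theorem fourierCoeff_smul (a : ℂ) (f : L2) (n : ℤ) :
    fourierCoeff ((a • f : L2) : Circ → ℂ) n = a * fourierCoeff (f : Circ → ℂ) n := by
  simp only [fourierCoeff_eq_inner, inner_smul_right]

theorem fourierCoeff_fourierLp (m n : ℤ) :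
    fourierCoeff (fourierLp (T := 2 * Real.pi) 2 m : Circ → ℂ) n = if n = m then 1 else 0 := by
  rw [fourierCoeff_eq_inner]
  exact orthonormal_iff_ite.1 orthonormal_fourier n m

theorem fourierCoeff_mul_norm_sq {ψ : Circ → ℝ} {g w : L2}
    (hw : w =ᵐ[arc] fun x => (ψ x : ℂ) * g x) (n : ℤ) :
    fourierCoeff (fun x => ((ψ x * ‖g x‖ ^ 2 : ℝ) : ℂ)) n = inner ℂ (shift n g) w := by
  rw [inner_eq_integral, fourierCoeff]
  refine integral_congr_ae ?_
  filter_upwards [hw, coeFn_shift n g] with x hx hn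
  rw [hx, hn, map_mul, fourier_neg, smul_eq_mul, Complex.ofReal_mul, Complex.ofReal_pow,
    ← Complex.conj_mul']
  ring

theorem norm_ae_eq_of_inner_shift_eq_zero {e : L2}
    (h : ∀ n : ℕ, n ≠ 0 → inner ℂ (shift n e) e = 0) : ∀ᵐ x ∂arc, ‖e x‖ = ‖e‖ := by
  have hsq : (fun x => ‖e x‖ ^ 2) =ᵐ[arc] fun _ => ‖e‖ ^ 2 := by
    refine ae_eq_of_fourierCoeff_natCast_eq (integrable_norm_sq e) (integrable_const _) fun n => ?_
    have hcoeff := fourierCoeff_mul_norm_sq (ψ := 1) (g := e) (w := e) (by simp) n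
    simp only [Pi.one_apply, one_mul] at hcoeff
    rw [hcoeff, fourierCoeff_const]
    rcases eq_or_ne n 0 with rfl | hn
    · simp [shift_zero, inner_self_eq_norm_sq_to_K]
    · rw [h n hn, if_neg (mod_cast hn)]
  filter_upwards [hsq] with x hx
  exact (sq_eq_sq₀ (norm_nonneg _) (norm_nonneg _)).1 hx

end Shift

section ShiftSpan

/-- The closed shift-invariant subspace generated by `k`: the closure of
`{p k : p a polynomial in z}`. -/
def shiftSpan (k : L2) : Submodule ℂ L2 :=
  (Submodule.span ℂ (Set.range fun n : ℕ => shift n k)).topologicalClosure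

theorem isClosed_shiftSpan (k : L2) : IsClosed (shiftSpan k : Set L2) :=
  Submodule.isClosed_topologicalClosure _

theorem shift_mem_shiftSpan (n : ℕ) (k : L2) : shift n k ∈ shiftSpan k :=
  Submodule.le_topologicalClosure _ (Submodule.subset_span ⟨n, rfl⟩)

theorem self_mem_shiftSpan (k : L2) : k ∈ shiftSpan k := by
  simpa only [Nat.cast_zero, shift_zero] using shift_mem_shiftSpan 0 k

theorem shiftSpan_le {S : Submodule ℂ L2} (hS : IsClosed (S : Set L2)) {k : L2}
    (h : ∀ n : ℕ, shift n k ∈ S) : shiftSpan k ≤ S := by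
  refine Submodule.topologicalClosure_minimal _ (Submodule.span_le.2 ?_) hS
  rintro _ ⟨n, rfl⟩
  exact h n

theorem map_mem_of_mem_shiftSpan (A : L2 →L[ℂ] L2) {S : Submodule ℂ L2}
    (hS : IsClosed (S : Set L2)) {k x : L2} (h : ∀ n : ℕ, A (shift n k) ∈ S)
    (hx : x ∈ shiftSpan k) : A x ∈ S :=
  shiftSpan_le (S := S.comap (A : L2 →ₗ[ℂ] L2)) (hS.preimage A.continuous) h hx

theorem map_eq_zero_of_mem_shiftSpan {E : Type*} [NormedAddCommGroup E] [NormedSpace ℂ E]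
    (A : L2 →L[ℂ] E) {k x : L2} (h : ∀ n : ℕ, A (shift n k) = 0) (hx : x ∈ shiftSpan k) :
    A x = 0 :=
  shiftSpan_le A.isClosed_ker h hx

theorem shift_mem_shiftSpan_of_mem (n : ℕ) {k x : L2} (hx : x ∈ shiftSpan k) :
    shift n x ∈ shiftSpan k := by
  refine map_mem_of_mem_shiftSpan (shift n) (isClosed_shiftSpan k) (fun j => ?_) hx
  rw [shift_shift, ← Nat.cast_add]
  exact shift_mem_shiftSpan _ k

theorem shiftSpan_shift_le (k : L2) : shiftSpan (shift 1 k) ≤ shiftSpan k :=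
  shiftSpan_le (isClosed_shiftSpan k) fun n =>
    shift_mem_shiftSpan_of_mem n (shift_mem_shiftSpan 1 k)

theorem mulOp_mem_shiftSpan (a : Lp ℂ ∞ arc) {k x : L2} (hx : x ∈ shiftSpan k) :
    mulOp a x ∈ shiftSpan (mulOp a k) := by
  refine map_mem_of_mem_shiftSpan (mulOp a) (isClosed_shiftSpan _) (fun n => ?_) hx
  rw [shift, mulOp_comm]
  exact shift_mem_shiftSpan n _

theorem ae_eq_zero_of_mem_shiftSpan {k x : L2} (hx : x ∈ shiftSpan k) :
    ∀ᵐ t ∂arc, k t = 0 → x t = 0 := by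
  have hZ : MeasurableSet {t | k t = 0} :=
    (Lp.stronglyMeasurable k).measurable (measurableSet_singleton 0)
  obtain ⟨a, ha⟩ : ∃ a : Lp ℂ ∞ arc, a =ᵐ[arc] {t | k t = 0}.indicator fun _ => 1 :=
    ⟨indicatorConstLp ∞ hZ (measure_ne_top _ _) 1, indicatorConstLp_coeFn⟩
  have hzero : mulOp a x = 0 := by
    refine map_eq_zero_of_mem_shiftSpan (mulOp a) (fun n => ?_) hx
    refine Lp.ext ?_
    filter_upwards [coeFn_mulOp a (shift n k), coeFn_shift n k, ha] with t hmul hn ht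
    by_cases hk : k t = 0 <;> simp [hmul, hn, ht, hk]
  filter_upwards [coeFn_mulOp a x, ha] with t hmul ht hk
  simpa [hzero, ht, hk] using hmul.symm

theorem exists_mem_shiftSpan_inner_shift_eq_zero {k : L2} (hk : k ∉ shiftSpan (shift 1 k)) :
    ∃ e ∈ shiftSpan k, e ≠ 0 ∧ ∀ n : ℕ, n ≠ 0 → inner ℂ e (shift n k) = 0 := by
  have : CompleteSpace (shiftSpan (shift 1 k)) := (isClosed_shiftSpan _).completeSpace_coe
  obtain ⟨p, hp, hperp⟩ : ∃ p ∈ shiftSpan (shift 1 k), k - p ∈ (shiftSpan (shift 1 k))ᗮ :=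
    ⟨_, Submodule.starProjection_apply_mem _ k, Submodule.sub_starProjection_mem_orthogonal k⟩
  refine ⟨k - p, sub_mem (self_mem_shiftSpan k) (shiftSpan_shift_le k hp),
    fun h => hk (by rwa [← sub_eq_zero.1 h] at hp), fun n hn => ?_⟩
  obtain ⟨j, rfl⟩ := Nat.exists_eq_succ_of_ne_zero hn
  have hmem : shift (j + 1 : ℕ) k ∈ shiftSpan (shift 1 k) := by
    rw [Nat.cast_succ, ← shift_shift]
    exact shift_mem_shiftSpan j _
  exact Submodule.inner_left_of_mem_orthogonal hmem hperp

theorem exists_mem_shiftSpan_norm_ae_eq_one {k : L2} (hk : k ∉ shiftSpan (shift 1 k)) :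
    ∃ e ∈ shiftSpan k, (∀ᵐ x ∂arc, ‖e x‖ = 1) ∧
      ∀ n : ℕ, n ≠ 0 → inner ℂ e (shift n k) = 0 := by
  obtain ⟨e, he, hne, horth⟩ := exists_mem_shiftSpan_inner_shift_eq_zero hk
  have hconst : ∀ᵐ x ∂arc, ‖e x‖ = ‖e‖ := norm_ae_eq_of_inner_shift_eq_zero fun n hn => by
    rw [← inner_conj_symm, map_eq_zero]
    refine map_eq_zero_of_mem_shiftSpan (innerSL ℂ e ∘L shift n) (fun j => ?_) he
    rw [ContinuousLinearMap.comp_apply, innerSL_apply_apply, shift_shift]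
    exact_mod_cast horth (n + j) (by omega)
  refine ⟨((‖e‖⁻¹ : ℝ) : ℂ) • e, Submodule.smul_mem _ _ he, ?_, fun n hn => ?_⟩
  · filter_upwards [hconst, Lp.coeFn_smul ((‖e‖⁻¹ : ℝ) : ℂ) e] with x hx hsmul
    rw [hsmul, Pi.smul_apply, norm_smul, hx, Complex.norm_real, norm_inv, norm_norm,
      inv_mul_cancel₀ (norm_ne_zero_iff.2 hne)]
  · rw [inner_smul_left, horth n hn, mul_zero]

end ShiftSpan

section Hardy

theorem fourierLp_mem_hardy (n : ℕ) : fourierLp (T := 2 * Real.pi) 2 (n : ℤ) ∈ hardy := by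
  intro j hj
  rw [fourierCoeff_fourierLp, if_neg (by omega)]

theorem one_mem_hardy : fourierLp (T := 2 * Real.pi) 2 0 ∈ hardy :=
  fourierLp_mem_hardy 0

theorem shift_mem_hardy (n : ℕ) {f : L2} (hf : f ∈ hardy) : shift n f ∈ hardy := by
  intro j hj
  rw [fourierCoeff_shift]
  exact hf _ (by omega)

theorem ext_fourierCoeff {f g : L2}
    (h : ∀ n, fourierCoeff (f : Circ → ℂ) n = fourierCoeff (g : Circ → ℂ) n) : f = g := by
  refine (fourierBasis (T := 2 * Real.pi)).repr.injective (lp.ext (funext fun n => ?_))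
  rw [fourierBasis_repr, fourierBasis_repr, h]

theorem hardy_le_of_fourierLp_mem {S : Submodule ℂ L2} (hS : IsClosed (S : Set L2))
    (h : ∀ n : ℕ, fourierLp (T := 2 * Real.pi) 2 (n : ℤ) ∈ S) : hardy ≤ S := by
  intro f hf
  refine hS.mem_of_tendsto (hasSum_fourier_series_L2 f) (.of_forall fun s => ?_)
  refine S.sum_mem fun n _ => ?_
  rcases lt_or_ge n 0 with hn | hn
  · rw [hf n hn, zero_smul]
    exact S.zero_mem
  · lift n to ℕ using hn
    exact S.smul_mem _ (h n)

theorem exists_lowest_fourierCoeff {g : L2} (hg : g ∈ hardy) (hg0 : g ≠ 0) :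
    ∃ N : ℤ, fourierCoeff (g : Circ → ℂ) N ≠ 0 ∧
      ∀ n < N, fourierCoeff (g : Circ → ℂ) n = 0 := by
  have hex : ∃ n, fourierCoeff (g : Circ → ℂ) n ≠ 0 := by
    by_contra! hall
    exact hg0 (ext_fourierCoeff fun n => by rw [hall, fourierCoeff_zero])
  obtain ⟨N, hN, hmin⟩ := Int.exists_least_of_bdd
    ⟨0, fun n hn => le_of_not_gt fun hlt => hn (hg n hlt)⟩ hex
  exact ⟨N, hN, fun n hn => not_not.1 fun h => (hmin n h).not_gt hn⟩

theorem notMem_shiftSpan_shift {g : L2} (hg : g ∈ hardy) (hg0 : g ≠ 0) :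
    g ∉ shiftSpan (shift 1 g) := by
  obtain ⟨N, hN, hlow⟩ := exists_lowest_fourierCoeff hg hg0
  intro hmem
  refine hN ?_
  rw [fourierCoeff_eq_inner]
  refine map_eq_zero_of_mem_shiftSpan (innerSL ℂ (fourierLp (T := 2 * Real.pi) 2 N))
    (fun n => ?_) hmem
  rw [innerSL_apply_apply, ← fourierCoeff_eq_inner, fourierCoeff_shift, fourierCoeff_shift]
  exact hlow _ (by omega)

theorem notMem_shiftSpan_shift_of_norm_le {k h : L2} {C : ℝ} (hh : h ∈ hardy) (hh0 : h ≠ 0)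
    (hC : ∀ᵐ x ∂arc, ‖h x‖ ≤ C * ‖k x‖) : k ∉ shiftSpan (shift 1 k) := by
  obtain ⟨a, hak, -⟩ := exists_mulOp_eq_of_norm_le hC
  intro hk
  refine notMem_shiftSpan_shift hh hh0 ?_
  have hmem := mulOp_mem_shiftSpan a hk
  rwa [shift, mulOp_comm, hak] at hmem

theorem ae_ne_zero_of_mem_hardy {g : L2} (hg : g ∈ hardy) (hg0 : g ≠ 0) :
    ∀ᵐ x ∂arc, g x ≠ 0 := by
  obtain ⟨e, he, hnorm, -⟩ := exists_mem_shiftSpan_norm_ae_eq_one (notMem_shiftSpan_shift hg hg0)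
  filter_upwards [ae_eq_zero_of_mem_shiftSpan he, hnorm] with x hx h1 hgx
  rw [hx hgx, norm_zero] at h1
  exact zero_ne_one h1

end Hardy

section Outer

theorem isOuter_iff_shiftSpan_eq {g : L2} : IsOuter g ↔ shiftSpan g = hardy := by
  have hshift (n : ℤ) : (fourierLp (T := 2 * Real.pi) ⊤ n • g : L2) = shift n g := by
    refine Lp.ext ?_
    filter_upwards [coeFn_mulOp (fourierLp ∞ n) g,
      Lp.coeFn_lpSMul (r := 2) (fourierLp (T := 2 * Real.pi) ⊤ n) g] with x hmul hsmul
    rw [shift, hmul, hsmul, Pi.smul_apply', smul_eq_mul]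
  simp only [IsOuter, shiftSpan, hshift]

theorem IsOuter.mem_hardy {f : L2} (hf : IsOuter f) : f ∈ hardy :=
  isOuter_iff_shiftSpan_eq.1 hf ▸ self_mem_shiftSpan f

theorem isOuter_of_one_mem_shiftSpan {f : L2} (hf : f ∈ hardy)
    (h1 : fourierLp (T := 2 * Real.pi) 2 0 ∈ shiftSpan f) : IsOuter f := by
  refine isOuter_iff_shiftSpan_eq.2 (le_antisymm ?_ ?_)
  · exact shiftSpan_le isClosed_hardy fun n => shift_mem_hardy n hf
  · refine hardy_le_of_fourierLp_mem (isClosed_shiftSpan f) fun n => ?_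
    have hn := shift_mem_shiftSpan_of_mem n h1
    rwa [shift_fourierLp, add_zero] at hn

theorem IsOuter.fourierCoeff_zero_ne_zero {f : L2} (hf : IsOuter f) :
    fourierCoeff (f : Circ → ℂ) 0 ≠ 0 := by
  intro h0
  have h1 : fourierLp (T := 2 * Real.pi) 2 0 ∈ shiftSpan f :=
    isOuter_iff_shiftSpan_eq.1 hf ▸ one_mem_hardy
  have hzero := map_eq_zero_of_mem_shiftSpan (innerSL ℂ (fourierLp (T := 2 * Real.pi) 2 0))
    (fun n => by
      rw [innerSL_apply_apply, ← fourierCoeff_eq_inner, fourierCoeff_shift]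
      rcases n.eq_zero_or_pos with rfl | hn
      · simpa using h0
      · exact hf.mem_hardy _ (by omega)) h1
  rw [innerSL_apply_apply, ← fourierCoeff_eq_inner, fourierCoeff_fourierLp, if_pos rfl] at hzero
  exact one_ne_zero hzero

theorem IsOuter.ne_zero {f : L2} (hf : IsOuter f) : f ≠ 0 := by
  rintro rfl
  exact hf.fourierCoeff_zero_ne_zero (fourierCoeff_zero 0)

theorem exists_isOuter_norm_eq {k : L2} (hk : k ∉ shiftSpan (shift 1 k)) :
    ∃ f : L2, IsOuter f ∧ ∀ᵐ x ∂arc, ‖f x‖ = ‖k x‖ := by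
  obtain ⟨e, he, hnorm, horth⟩ := exists_mem_shiftSpan_norm_ae_eq_one hk
  have hone := coeFn_fourierLp (T := 2 * Real.pi) 2 0
  obtain ⟨a, hae, ha⟩ := exists_mulOp_eq_of_norm_le (h := fourierLp (T := 2 * Real.pi) 2 0)
    (k := e) (C := 1) (by
      filter_upwards [hnorm, hone] with x hx h1
      rw [h1, hx, fourier_zero, norm_one, one_mul])
  have ha_conj : ∀ᵐ x ∂arc, a x = conj (e x) := by
    filter_upwards [hnorm, hone, ha] with x hx h1 hax
    rw [hax, h1, fourier_zero, one_div, Complex.inv_def, Complex.normSq_eq_norm_sq, hx]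
    simp
  refine ⟨mulOp a k, isOuter_of_one_mem_shiftSpan (fun n hn => ?_)
    (hae ▸ mulOp_mem_shiftSpan a he), ?_⟩
  · have hcoeff : fourierCoeff (mulOp a k : Circ → ℂ) n = inner ℂ e (shift (-n) k) := by
      rw [inner_eq_integral, fourierCoeff]
      refine integral_congr_ae ?_
      filter_upwards [coeFn_mulOp a k, ha_conj, coeFn_shift (-n) k] with x hmul hax hshift
      rw [hmul, hax, hshift, smul_eq_mul, mul_left_comm]
    obtain ⟨j, hj⟩ := Int.eq_ofNat_of_zero_le (neg_nonneg.2 hn.le)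
    rw [hcoeff, hj]
    exact horth j (by omega)
  · filter_upwards [coeFn_mulOp a k, ha_conj, hnorm] with x hmul hax hx
    rw [hmul, hax, norm_mul, RCLike.norm_conj, hx, one_mul]

theorem exists_isOuter_norm_sq_eq {w : Circ → ℝ} (hw : Integrable w arc)
    (hw0 : ∀ᵐ x ∂arc, 0 ≤ w x) {h : L2} (hh : h ∈ hardy) (hh0 : h ≠ 0) {C : ℝ}
    (hC : ∀ᵐ x ∂arc, ‖h x‖ ^ 2 ≤ C * w x) :
    ∃ f : L2, IsOuter f ∧ ∀ᵐ x ∂arc, ‖f x‖ ^ 2 = w x := by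
  have hmeas : AEStronglyMeasurable (fun x => ((√(w x) : ℝ) : ℂ)) arc :=
    (Complex.continuous_ofReal.comp Real.continuous_sqrt).comp_aestronglyMeasurable hw.1
  have hsq : ∀ᵐ x ∂arc, ‖((√(w x) : ℝ) : ℂ)‖ ^ 2 = w x := hw0.mono fun x hx => by
    rw [Complex.norm_real, Real.norm_eq_abs, sq_abs, Real.sq_sqrt hx]
  have hL2 : MemLp (fun x => ((√(w x) : ℝ) : ℂ)) 2 arc :=
    (memLp_two_iff_integrable_sq_norm hmeas).2 (hw.congr (hsq.mono fun x hx => hx.symm))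
  have hk : ∀ᵐ x ∂arc, ‖hL2.toLp _ x‖ ^ 2 = w x := by
    filter_upwards [hL2.coeFn_toLp, hsq] with x hx hsqx
    rw [hx, hsqx]
  have hdom : ∀ᵐ x ∂arc, ‖h x‖ ≤ √|C| * ‖hL2.toLp _ x‖ := by
    filter_upwards [hk, hC, hw0] with x hkx hCx h0
    refine (sq_le_sq₀ (norm_nonneg _) (by positivity)).1 ?_
    rw [mul_pow, Real.sq_sqrt (abs_nonneg C), hkx]
    exact hCx.trans (mul_le_mul_of_nonneg_right (le_abs_self C) h0)
  obtain ⟨f, hf, hfk⟩ :=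
    exists_isOuter_norm_eq (notMem_shiftSpan_shift_of_norm_le hh hh0 hdom)
  refine ⟨f, hf, ?_⟩
  filter_upwards [hfk, hk] with x hfx hkx
  rw [hfx, hkx]

theorem IsOuter.exists_mem_hardy_eq_div {f h : L2} (hf : IsOuter f) (hh : h ∈ hardy) {C : ℝ}
    (hC : ∀ᵐ x ∂arc, ‖h x‖ ≤ C * ‖f x‖) : ∃ q ∈ hardy, q =ᵐ[arc] fun x => h x / f x := by
  obtain ⟨a, haf, ha⟩ := exists_mulOp_eq_of_norm_le hC
  refine ⟨mulOp a (fourierLp 2 0), map_mem_of_mem_shiftSpan (k := f) (mulOp a) isClosed_hardy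
    (fun n => ?_) (isOuter_iff_shiftSpan_eq.1 hf ▸ one_mem_hardy), ?_⟩
  · rw [shift, mulOp_comm, haf]
    exact shift_mem_hardy n hh
  · filter_upwards [coeFn_mulOp a (fourierLp 2 0), ha, coeFn_fourierLp (T := 2 * Real.pi) 2 0]
      with x hmul hax h1
    rw [hmul, hax, h1, fourier_zero, mul_one]

theorem exists_ae_eq_const_of_conj_mem_hardy {p q : L2} (hp : p ∈ hardy) (hq : q ∈ hardy)
    (hpq : q =ᵐ[arc] fun x => conj (p x)) : ∃ u : ℂ, ∀ᵐ x ∂arc, p x = u := by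
  set u := fourierCoeff (p : Circ → ℂ) 0
  have hpu : p = u • fourierLp (T := 2 * Real.pi) 2 0 := by
    refine ext_fourierCoeff fun n => ?_
    rw [fourierCoeff_smul, fourierCoeff_fourierLp]
    rcases lt_trichotomy n 0 with hn | rfl | hn
    · rw [hp n hn, if_neg hn.ne, mul_zero]
    · rw [if_pos rfl, mul_one]
    · have hqn := hq (-n) (by omega)
      rw [fourierCoeff_congr_ae hpq, fourierCoeff_conj, neg_neg, map_eq_zero] at hqn
      rw [hqn, if_neg hn.ne', mul_zero]
  refine ⟨u, ?_⟩
  filter_upwards [Lp.coeFn_smul u (fourierLp (T := 2 * Real.pi) 2 0),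
    coeFn_fourierLp (T := 2 * Real.pi) 2 0] with x hsmul h1
  rw [hpu, hsmul, Pi.smul_apply, h1, fourier_zero, smul_eq_mul, mul_one]

theorem IsOuter.eq_smul_of_norm_eq {f h : L2} (hf : IsOuter f) (hh : IsOuter h)
    (hfh : ∀ᵐ x ∂arc, ‖f x‖ = ‖h x‖) : ∃ u : ℂ, ‖u‖ = 1 ∧ h = u • f := by
  obtain ⟨p, hp, hp_eq⟩ := hf.exists_mem_hardy_eq_div hh.mem_hardy (C := 1)
    (hfh.mono fun x hx => by rw [one_mul, hx])
  obtain ⟨q, hq, hq_eq⟩ := hh.exists_mem_hardy_eq_div hf.mem_hardy (C := 1)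
    (hfh.mono fun x hx => by rw [one_mul, hx])
  have hf0 := ae_ne_zero_of_mem_hardy hf.mem_hardy hf.ne_zero
  have hp_norm : ∀ᵐ x ∂arc, ‖p x‖ = 1 := by
    filter_upwards [hp_eq, hfh, hf0] with x hpx hx h0
    rw [hpx, norm_div, ← hx, div_self (norm_ne_zero_iff.2 h0)]
  have hq_conj : q =ᵐ[arc] fun x => conj (p x) := by
    filter_upwards [hp_eq, hq_eq, hp_norm] with x hpx hqx hx
    rw [← Complex.inv_eq_conj hx, hqx, hpx, inv_div]
  obtain ⟨u, hu⟩ := exists_ae_eq_const_of_conj_mem_hardy hp hq hq_conj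
  refine ⟨u, ?_, Lp.ext ?_⟩
  · obtain ⟨x, hux, hx⟩ := (hu.and hp_norm).exists
    rw [← hux, hx]
  · filter_upwards [hp_eq, hu, hf0, Lp.coeFn_smul u f] with x hpx hux h0 hsmul
    rw [hsmul, Pi.smul_apply, ← hux, hpx, smul_eq_mul, div_mul_cancel₀ _ h0]

end Outer

section Trig

theorem trig_eq (c : ℂ) (x : Circ) : trig c x = 2 * (c * fourier 1 x).re := by
  rw [trig, Complex.add_re, Complex.conj_re, ← two_mul]

theorem trig_ofReal_mul (r : ℝ) (c : ℂ) (x : Circ) : trig (r * c) x = r * trig c x := by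
  rw [trig_eq, trig_eq, mul_assoc, Complex.re_ofReal_mul, mul_left_comm]

theorem trig_neg (c : ℂ) (x : Circ) : trig (-c) x = -trig c x := by
  simpa using trig_ofReal_mul (-1) c x

theorem trig_zero (x : Circ) : trig 0 x = 0 := by
  simpa using trig_ofReal_mul 0 0 x

theorem continuous_trig (c : ℂ) : Continuous (trig c) := by
  unfold trig
  fun_prop

theorem norm_fourier_apply (n : ℤ) (x : Circ) : ‖fourier n x‖ = 1 :=
  Circle.norm_coe _

theorem abs_trig_le (c : ℂ) (x : Circ) : |trig c x| ≤ 2 * ‖c‖ := by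
  rw [trig_eq, abs_mul, abs_two, ← mul_one ‖c‖, ← norm_fourier_apply 1 x, ← norm_mul]
  exact mul_le_mul_of_nonneg_left (Complex.abs_re_le_norm _) zero_le_two

theorem integrable_trig (c : ℂ) : Integrable (trig c) arc :=
  .of_bound (continuous_trig c).aestronglyMeasurable (2 * ‖c‖) (.of_forall (abs_trig_le c))

theorem fourierCoeff_trig (c : ℂ) (n : ℤ) : fourierCoeff (fun x => (trig c x : ℂ)) n
    = (if n = 1 then c else 0) + if n = -1 then conj c else 0 := by
  have hmono (a : ℂ) (m : ℤ) : Integrable (fun x : Circ => a * fourier m x) arc :=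
    (map_continuous (fourier m)).integrable_of_hasCompactSupport
      (HasCompactSupport.of_compactSpace _) |>.const_mul a
  have htrig : (fun x => (trig c x : ℂ))
      = (fun x => c * fourier 1 x) + fun x => conj c * fourier (-1) x := by
    funext x
    rw [trig_coe, Pi.add_apply, map_mul, fourier_neg]
  rw [htrig, fourierCoeff.add (hmono _ _) (hmono _ _), Pi.add_apply, fourierCoeff.const_mul,
    fourierCoeff.const_mul, fourierCoeff_fourier, fourierCoeff_fourier]
  simp only [Pi.single_apply, mul_ite, mul_one, mul_zero]

-- `χ (cχ + (cχ)^*) = c χ² + c^*` is a polynomial.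
theorem exists_mem_hardy_norm_eq_abs_trig {c : ℂ} (hc : c ≠ 0) :
    ∃ h ∈ hardy, h ≠ 0 ∧ ∀ᵐ x ∂arc, ‖h x‖ = |trig c x| := by
  have he (n : ℤ) := coeFn_fourierLp (T := 2 * Real.pi) 2 n
  refine ⟨c • fourierLp 2 2 + conj c • fourierLp 2 0, add_mem
    (hardy.smul_mem _ (fourierLp_mem_hardy 2)) (hardy.smul_mem _ one_mem_hardy),
    fun h0 => hc ?_, ?_⟩
  · have h2 := congrArg (inner ℂ (fourierLp (T := 2 * Real.pi) 2 2)) h0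
    simpa only [inner_add_right, inner_smul_right, ← fourierCoeff_eq_inner, fourierCoeff_zero,
      fourierCoeff_fourierLp, OfNat.ofNat_ne_zero, if_true, if_false, mul_one, mul_zero, add_zero]
      using h2
  · filter_upwards [Lp.coeFn_add (c • fourierLp (T := 2 * Real.pi) 2 2) (conj c • fourierLp 2 0),
      Lp.coeFn_smul c (fourierLp (T := 2 * Real.pi) 2 2),
      Lp.coeFn_smul (conj c) (fourierLp (T := 2 * Real.pi) 2 0), he 2, he 0]
      with x hadd hsmul2 hsmul0 h2 h0
    have hfactor : c * fourier 2 x + conj c = fourier 1 x * (trig c x : ℂ) := by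
      rw [trig_coe, map_mul, ← fourier_neg, mul_add, mul_left_comm, ← fourier_add, mul_left_comm,
        ← fourier_add, one_add_one_eq_two, add_neg_cancel, fourier_zero, mul_one]
    rw [hadd, Pi.add_apply, hsmul2, hsmul0, Pi.smul_apply, Pi.smul_apply, h2, h0, fourier_zero,
      smul_eq_mul, smul_eq_mul, mul_one, hfactor, norm_mul, norm_fourier_apply, one_mul,
      Complex.norm_real, Real.norm_eq_abs]

theorem ae_trig_ne_zero {c : ℂ} (hc : c ≠ 0) : ∀ᵐ x ∂arc, trig c x ≠ 0 := by
  obtain ⟨h, hh, hh0, hnorm⟩ := exists_mem_hardy_norm_eq_abs_trig hc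
  filter_upwards [ae_ne_zero_of_mem_hardy hh hh0, hnorm] with x hx hxc
  rwa [← abs_ne_zero, ← hxc, norm_ne_zero_iff]

theorem integral_trig (c : ℂ) : ∫ x, trig c x ∂arc = 0 := by
  have h0 := fourierCoeff_trig c 0
  simp only [fourierCoeff, neg_zero, fourier_zero, one_smul, integral_complex_ofReal] at h0
  simpa using h0

theorem frequently_trig_neg {c : ℂ} (hc : c ≠ 0) : ∃ᵐ x ∂arc, trig c x < 0 := by
  intro hnn
  have hzero := (integral_eq_zero_iff_of_nonneg_ae (hnn.mono fun x hx => not_lt.1 hx)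
    (integrable_trig c)).1 (integral_trig c)
  obtain ⟨x, hx, hx0⟩ := (hzero.and (ae_trig_ne_zero hc)).exists
  exact hx0 hx

theorem frequently_trig_pos {c : ℂ} (hc : c ≠ 0) : ∃ᵐ x ∂arc, 0 < trig c x :=
  (frequently_trig_neg (neg_ne_zero.2 hc)).mono fun x hx => by rwa [trig_neg, neg_lt_zero] at hx

theorem exists_nonneg_eq_mul_of_re_mul_re_nonneg {c d : ℂ} (hc : c ≠ 0)
    (h : ∀ u : ℂ, 0 ≤ (d * u).re * (c * u).re) : ∃ t : ℝ, 0 ≤ t ∧ d = t * c := by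
  have hline (y : ℝ) : 0 ≤ (d / c).re - y * (d / c).im := by
    have hy := h ((1 + y * Complex.I) / c)
    rw [mul_div_cancel₀ _ hc, mul_div_left_comm, mul_comm] at hy
    simpa [mul_comm y] using hy
  have him : (d / c).im = 0 := by
    by_contra hne
    have hy := hline (((d / c).re + 1) / (d / c).im)
    rw [div_mul_cancel₀ _ hne] at hy
    linarith
  refine ⟨(d / c).re, by simpa using hline 0, ?_⟩
  rw [← div_eq_iff hc]
  exact Complex.ext rfl him

theorem exists_eq_norm_mul_fourier_one (u : ℂ) : ∃ x : Circ, u = ‖u‖ * fourier 1 x := by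
  refine ⟨(u.arg : ℝ), ?_⟩
  have harg : 2 * Real.pi * Complex.I * (1 : ℤ) * u.arg / (2 * Real.pi : ℝ)
      = u.arg * Complex.I := by
    have hpi : (Real.pi : ℂ) ≠ 0 := mod_cast Real.pi_ne_zero
    push_cast
    field_simp
  rw [fourier_coe_apply, harg, Complex.norm_mul_exp_arg_mul_I]

theorem re_mul_re_nonneg_of_trig_mul_nonneg {c d : ℂ}
    (h : ∀ᵐ x ∂arc, 0 ≤ trig d x * trig c x) (u : ℂ) : 0 ≤ (d * u).re * (c * u).re := by
  have hclosed : IsClosed {x | 0 ≤ trig d x * trig c x} :=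
    isClosed_le continuous_const ((continuous_trig d).mul (continuous_trig c))
  have hall (x : Circ) : 0 ≤ trig d x * trig c x :=
    hclosed.closure_subset (Measure.dense_of_ae h x)
  obtain ⟨x, hx⟩ := exists_eq_norm_mul_fourier_one u
  have hre (a : ℂ) : (a * u).re = ‖u‖ / 2 * trig a x := by
    rw [trig_eq, hx, mul_left_comm, Complex.re_ofReal_mul, ← hx]
    ring
  rw [hre, hre, mul_mul_mul_comm]
  exact mul_nonneg (mul_self_nonneg _) (hall x)

theorem exists_nonneg_eq_mul_of_trig_mul_nonneg {c d : ℂ} (hc : c ≠ 0)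
    (h : ∀ᵐ x ∂arc, 0 ≤ trig d x * trig c x) : ∃ t : ℝ, 0 ≤ t ∧ d = t * c :=
  exists_nonneg_eq_mul_of_re_mul_re_nonneg hc (re_mul_re_nonneg_of_trig_mul_nonneg h)

end Trig

section Eigenvectors

variable {φ : Symbol} {lam : ℝ}

theorem coeFn_mulSymbol_sub_smul (φ : Symbol) (lam : ℝ) (g : L2) :
    (mulSymbol φ g - (lam : ℂ) • g : L2) =ᵐ[arc] fun x => ((φ x - lam : ℝ) : ℂ) * g x := by
  filter_upwards [Lp.coeFn_sub (mulSymbol φ g) ((lam : ℂ) • g), mulSymbol_coe φ g,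
    Lp.coeFn_smul (lam : ℂ) g] with x hsub hmul hsmul
  rw [hsub, Pi.sub_apply, hmul, hsmul, Pi.smul_apply, smul_eq_mul, Complex.ofReal_sub, sub_mul]

theorem isNeilEigenvector_iff {g : L2} :
    IsNeilEigenvector φ lam g ↔ ∃ V ≤ lowDegree, g ∈ hardySub V ∧ g ≠ 0 ∧
      ∀ h ∈ hardySub V, inner ℂ h (mulSymbol φ g - (lam : ℂ) • g) = 0 := by
  have hiff (V : Submodule ℂ L2) (hg : g ∈ hardySub V) :
      toeplitz φ V ⟨g, hg⟩ = (lam : ℂ) • (⟨g, hg⟩ : hardySub V) ↔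
        ∀ h ∈ hardySub V, inner ℂ h (mulSymbol φ g - (lam : ℂ) • g) = 0 := by
    have hproj : toeplitz φ V ⟨g, hg⟩ - (lam : ℂ) • (⟨g, hg⟩ : hardySub V)
        = (hardySub V).orthogonalProjectionOnto (mulSymbol φ g - (lam : ℂ) • g) := by
      rw [map_sub, map_smul,
        (hardySub V).orthogonalProjectionOnto_mem_subspace_eq_self ⟨g, hg⟩]
      rfl
    rw [← sub_eq_zero, hproj, Submodule.orthogonalProjectionOnto_eq_zero_iff,
      Submodule.mem_orthogonal]
  constructor
  · rintro ⟨V, hV, hg, hne, h⟩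
    exact ⟨V, hV, hg, hne, (hiff V hg).1 h⟩
  · rintro ⟨V, hV, hg, hne, h⟩
    exact ⟨V, hV, hg, hne, (hiff V hg).2 h⟩

theorem mem_hardySub_lowDegree_inf_orthogonal {f : L2} (hf : f ∈ hardy) :
    f ∈ hardySub (lowDegree ⊓ (Submodule.span ℂ {f})ᗮ) :=
  ⟨hf, (Submodule.mem_orthogonal _ _).2 fun _ hv =>
    Submodule.mem_orthogonal_singleton_iff_inner_left.1 hv.2⟩

theorem fourierCoeff_one_eq_zero_of_mem_hardySub {f r : L2}
    (hf0 : fourierCoeff (f : Circ → ℂ) 0 ≠ 0)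
    (hr : r ∈ hardySub (lowDegree ⊓ (Submodule.span ℂ {f})ᗮ))
    (hr0 : fourierCoeff (r : Circ → ℂ) 0 = 0) : fourierCoeff (r : Circ → ℂ) 1 = 0 := by
  set f₀ := fourierCoeff (f : Circ → ℂ) 0
  set f₁ := fourierCoeff (f : Circ → ℂ) 1
  -- `v` spans the part of `ℂ ⊕ ℂ z` orthogonal to `f`.
  set v : L2 := conj f₁ • fourierLp 2 0 - conj f₀ • fourierLp 2 1
  have hv (w : L2) : inner ℂ v w
      = f₁ * fourierCoeff (w : Circ → ℂ) 0 - f₀ * fourierCoeff (w : Circ → ℂ) 1 := by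
    rw [inner_sub_left, inner_smul_left, inner_smul_left, Complex.conj_conj, Complex.conj_conj,
      ← fourierCoeff_eq_inner, ← fourierCoeff_eq_inner]
  have hvlow : v ∈ lowDegree := sub_mem
    (lowDegree.smul_mem _ (Submodule.subset_span (Set.mem_insert _ _)))
    (lowDegree.smul_mem _ (Submodule.subset_span (Set.mem_insert_of_mem _ rfl)))
  have hvf : inner ℂ v f = 0 := by rw [hv, mul_comm, sub_self]
  have hvr : inner ℂ v r = 0 := (Submodule.mem_orthogonal _ _).1 hr.2 v
    ⟨hvlow, Submodule.mem_orthogonal_singleton_iff_inner_left.2 hvf⟩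
  rw [hv, hr0, mul_zero, zero_sub, neg_eq_zero] at hvr
  exact (mul_eq_zero.1 hvr).resolve_left hf0

theorem exists_eq_smul_add_shift_two {f g : L2} (hf : f ∈ hardy)
    (hf0 : fourierCoeff (f : Circ → ℂ) 0 ≠ 0)
    (hg : g ∈ hardySub (lowDegree ⊓ (Submodule.span ℂ {f})ᗮ)) :
    ∃ a : ℂ, ∃ x ∈ hardy, g = a • f + shift 2 x := by
  set a := fourierCoeff (g : Circ → ℂ) 0 / fourierCoeff (f : Circ → ℂ) 0
  have hr := sub_mem hg (Submodule.smul_mem _ a (mem_hardySub_lowDegree_inf_orthogonal hf))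
  have hr0 : fourierCoeff ((g - a • f : L2) : Circ → ℂ) 0 = 0 := by
    rw [fourierCoeff_sub, fourierCoeff_smul, div_mul_cancel₀ _ hf0, sub_self]
  have hr1 := fourierCoeff_one_eq_zero_of_mem_hardySub hf0 hr hr0
  refine ⟨a, shift (-2) (g - a • f), fun n hn => ?_, ?_⟩
  · rw [fourierCoeff_shift]
    rcases lt_or_ge n (-2) with hlt | hge
    · exact hr.1 _ (by omega)
    · obtain rfl | rfl : n = -2 ∨ n = -1 := by omega
      exacts [hr0, hr1]
  · rw [shift_shift, add_neg_cancel, shift_zero, add_sub_cancel]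

theorem isNeilEigenvector_of_isOuter {c : ℂ} {f : L2} (hf : IsOuter f)
    (h : ∀ᵐ x ∂arc, (φ x - lam) * ‖f x‖ ^ 2 = trig c x) : IsNeilEigenvector φ lam f := by
  set w := mulSymbol φ f - (lam : ℂ) • f
  have hcoeff (n : ℕ) (hn : n ≠ 1) : inner ℂ (shift n f) w = 0 := by
    rw [← fourierCoeff_mul_norm_sq (coeFn_mulSymbol_sub_smul φ lam f) n,
      fourierCoeff_congr_ae (h.mono fun x hx => congrArg Complex.ofReal hx), fourierCoeff_trig,
      if_neg (by omega), if_neg (by omega), add_zero]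
  have hself : inner ℂ f w = 0 := by simpa [shift_zero] using hcoeff 0 zero_ne_one
  have hshift (x : L2) (hx : x ∈ hardy) : inner ℂ (shift 2 x) w = 0 := by
    rw [← isOuter_iff_shiftSpan_eq.1 hf] at hx
    rw [← inner_conj_symm, map_eq_zero]
    refine map_eq_zero_of_mem_shiftSpan (innerSL ℂ w ∘L shift 2) (fun n => ?_) hx
    rw [ContinuousLinearMap.comp_apply, innerSL_apply_apply, shift_shift, ← inner_conj_symm,
      map_eq_zero]
    exact_mod_cast hcoeff (2 + n) (by omega)
  refine isNeilEigenvector_iff.2 ⟨lowDegree ⊓ (Submodule.span ℂ {f})ᗮ, inf_le_left,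
    mem_hardySub_lowDegree_inf_orthogonal hf.mem_hardy, hf.ne_zero, fun g hg => ?_⟩
  obtain ⟨a, x, hx, rfl⟩ :=
    exists_eq_smul_add_shift_two hf.mem_hardy hf.fourierCoeff_zero_ne_zero hg
  rw [inner_add_left, inner_smul_left, hself, hshift x hx, mul_zero, add_zero]

theorem shift_mem_hardySub {V : Submodule ℂ L2} (hV : V ≤ lowDegree) {g : L2}
    (hg : g ∈ hardy) {n : ℕ} (hn : 2 ≤ n) : shift n g ∈ hardySub V := by
  have hlow : lowDegree ≤ (Submodule.span ℂ {shift n g})ᗮ := by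
    refine Submodule.span_le.2 ?_
    rintro _ (rfl | rfl)
    all_goals
      refine Submodule.mem_orthogonal_singleton_iff_inner_left.2 ?_
      rw [← fourierCoeff_eq_inner, fourierCoeff_shift]
      exact hg _ (by omega)
  exact ⟨shift_mem_hardy n hg, (Submodule.mem_orthogonal _ _).2 fun v hv =>
    Submodule.mem_orthogonal_singleton_iff_inner_left.1 (hlow (hV hv))⟩

theorem ae_abs_symbol_sub_le (φ : Symbol) (lam : ℝ) :
    ∀ᵐ x ∂arc, |φ x - lam| ≤ ‖φ‖ + |lam| := by
  have hbound : ∀ᵐ x ∂arc, ‖φ x‖ ≤ ‖φ‖ := by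
    rw [Lp.norm_def, toReal_eLpNorm (Lp.aestronglyMeasurable φ)]
    exact ae_le_lpNorm_exponent_top (Lp.memLp φ)
  filter_upwards [hbound] with x hx
  exact (abs_sub _ _).trans (add_le_add_left hx _)

theorem integrable_symbol_sub_mul_norm_sq (φ : Symbol) (lam : ℝ) (g : L2) :
    Integrable (fun x => (φ x - lam) * ‖g x‖ ^ 2) arc :=
  (integrable_norm_sq g).bdd_mul
    ((Lp.aestronglyMeasurable φ).sub aestronglyMeasurable_const) (ae_abs_symbol_sub_le φ lam)

theorem IsNeilEigenvector.exists_eq_trig {g : L2} (h : IsNeilEigenvector φ lam g) :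
    ∃ d : ℂ, ∀ᵐ x ∂arc, (φ x - lam) * ‖g x‖ ^ 2 = trig d x := by
  obtain ⟨V, hV, hg, -, horth⟩ := isNeilEigenvector_iff.1 h
  have hcoeff (n : ℕ) := fourierCoeff_mul_norm_sq (coeFn_mulSymbol_sub_smul φ lam g) n
  refine ⟨inner ℂ (shift 1 g) (mulSymbol φ g - (lam : ℂ) • g),
    ae_eq_of_fourierCoeff_natCast_eq (integrable_symbol_sub_mul_norm_sq φ lam g)
      (integrable_trig _) fun n => ?_⟩
  rw [hcoeff, fourierCoeff_trig, if_neg (by omega : (n : ℤ) ≠ -1), add_zero]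
  match n with
  | 0 => simpa [shift_zero] using horth g hg
  | 1 => simp
  | n + 2 =>
    rw [if_neg (by omega)]
    exact horth _ (shift_mem_hardySub hV hg.1 (by omega))

theorem exists_isOuter_of_quotientMemL1 {c : ℂ} (hc : c ≠ 0)
    (hsign : ∀ᵐ x ∂arc, 0 ≤ (φ x - lam) * trig c x)
    (hq : QuotientMemL1 (trig c) (fun x => φ x - lam)) :
    ∃ f : L2, IsOuter f ∧ ∀ᵐ x ∂arc, (φ x - lam) * ‖f x‖ ^ 2 = trig c x := by
  obtain ⟨hne, hint⟩ := hq
  obtain ⟨h, hh, hh0, hnorm⟩ := exists_mem_hardy_norm_eq_abs_trig hc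
  have hw0 : ∀ᵐ x ∂arc, 0 ≤ trig c x / (φ x - lam) := hsign.mono fun x hx => by
    rwa [div_nonneg_iff, ← mul_nonneg_iff, mul_comm]
  have hdom : ∀ᵐ x ∂arc,
      ‖h x‖ ^ 2 ≤ 2 * ‖c‖ * (‖φ‖ + |lam|) * (trig c x / (φ x - lam)) := by
    filter_upwards [hnorm, hw0, hne, ae_abs_symbol_sub_le φ lam] with x hhx hwx hnex hφx
    have habs : |trig c x| = |φ x - lam| * (trig c x / (φ x - lam)) := by
      rw [← abs_of_nonneg hwx, ← abs_mul, mul_div_cancel₀ _ hnex]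
    calc ‖h x‖ ^ 2 = |trig c x| * (|φ x - lam| * (trig c x / (φ x - lam))) := by
          rw [hhx, ← habs, sq]
      _ ≤ 2 * ‖c‖ * ((‖φ‖ + |lam|) * (trig c x / (φ x - lam))) := by
          gcongr
          exact abs_trig_le c x
      _ = 2 * ‖c‖ * (‖φ‖ + |lam|) * (trig c x / (φ x - lam)) := (mul_assoc _ _ _).symm
  obtain ⟨f, hf, hfw⟩ := exists_isOuter_norm_sq_eq hint hw0 hh hh0 hdom
  refine ⟨f, hf, ?_⟩
  filter_upwards [hfw, hne] with x hx hnex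
  rw [hx, mul_div_cancel₀ _ hnex]

theorem IsNeilEigenvector.quotientMemL1 {c : ℂ} (hc : c ≠ 0)
    (hsign : ∀ᵐ x ∂arc, 0 ≤ (φ x - lam) * trig c x) (hφ : ¬ ∀ᵐ x ∂arc, φ x = lam) {g : L2}
    (hg : IsNeilEigenvector φ lam g) : QuotientMemL1 (trig c) (fun x => φ x - lam) := by
  obtain ⟨d, hd⟩ := hg.exists_eq_trig
  obtain ⟨t, -, rfl⟩ := exists_nonneg_eq_mul_of_trig_mul_nonneg hc (d := d) (by
    filter_upwards [hd, hsign] with x hx hsx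
    rw [← hx, mul_right_comm]
    positivity)
  simp only [trig_ofReal_mul] at hd
  have ht : t ≠ 0 := by
    rintro rfl
    obtain ⟨V, -, hgV, hg0, -⟩ := isNeilEigenvector_iff.1 hg
    refine hφ ?_
    filter_upwards [hd, ae_ne_zero_of_mem_hardy hgV.1 hg0] with x hx hgx
    rw [zero_mul, mul_eq_zero, sub_eq_zero] at hx
    exact hx.resolve_right (pow_ne_zero 2 (norm_ne_zero_iff.2 hgx))
  have hne : ∀ᵐ x ∂arc, φ x - lam ≠ 0 := by
    filter_upwards [hd, ae_trig_ne_zero hc] with x hx hcx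
    exact left_ne_zero_of_mul (hx ▸ mul_ne_zero ht hcx)
  refine ⟨hne, ((integrable_norm_sq g).const_mul t⁻¹).congr ?_⟩
  filter_upwards [hd, hne] with x hx hnex
  rw [eq_div_iff hnex, mul_assoc, mul_comm _ (φ x - lam), hx, inv_mul_cancel_left₀ ht]

theorem isNeilEigenvalue_iff_quotientMemL1 {c : ℂ} (hc : c ≠ 0)
    (hsign : ∀ᵐ x ∂arc, 0 ≤ (φ x - lam) * trig c x) (hφ : ¬ ∀ᵐ x ∂arc, φ x = lam) :
    IsNeilEigenvalue φ lam ↔ QuotientMemL1 (trig c) (fun x => φ x - lam) := by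
  refine ⟨fun ⟨g, hg⟩ => hg.quotientMemL1 hc hsign hφ, fun hq => ?_⟩
  obtain ⟨f, hf, hfc⟩ := exists_isOuter_of_quotientMemL1 hc hsign hq
  exact ⟨f, isNeilEigenvector_of_isOuter hf hfc⟩

theorem quotientMemL1_of_le_abs (c : ℂ) {δ : ℝ} (hδ : 0 < δ)
    (h : ∀ᵐ x ∂arc, δ ≤ |φ x - lam|) : QuotientMemL1 (trig c) (fun x => φ x - lam) := by
  refine ⟨h.mono fun x hx => abs_pos.1 (hδ.trans_le hx), .of_bound (C := 2 * ‖c‖ / δ)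
    ((continuous_trig c).aestronglyMeasurable.div₀
      ((Lp.aestronglyMeasurable φ).sub aestronglyMeasurable_const)) ?_⟩
  filter_upwards [h] with x hx
  rw [norm_div, Real.norm_eq_abs, Real.norm_eq_abs]
  gcongr
  exact abs_trig_le c x

theorem IsOuter.eq_smul_of_mul_norm_sq_eq {f h : L2} (hf : IsOuter f) (hh : IsOuter h)
    {ψ : Circ → ℝ} (hψ : ∀ᵐ x ∂arc, ψ x ≠ 0)
    (hfh : ∀ᵐ x ∂arc, ψ x * ‖f x‖ ^ 2 = ψ x * ‖h x‖ ^ 2) : ∃ u : ℂ, ‖u‖ = 1 ∧ h = u • f := by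
  refine hf.eq_smul_of_norm_eq hh ?_
  filter_upwards [hψ, hfh] with x hx hfhx
  exact (sq_eq_sq₀ (norm_nonneg _) (norm_nonneg _)).1 (mul_left_cancel₀ hx hfhx)

end Eigenvectors

section GapCondition

variable {φ : Symbol} {c : ℂ} {m M lam : ℝ}

theorem ae_sub_mul_trig_nonneg (hneg : ∀ᵐ x ∂arc, trig c x < 0 → φ x ≤ m)
    (hpos : ∀ᵐ x ∂arc, 0 < trig c x → M ≤ φ x) (hlam : lam ∈ Set.Icc m M) :
    ∀ᵐ x ∂arc, 0 ≤ (φ x - lam) * trig c x := by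
  filter_upwards [hneg, hpos] with x hxneg hxpos
  rcases lt_trichotomy (trig c x) 0 with hx | hx | hx
  · exact mul_nonneg_of_nonpos_of_nonpos (sub_nonpos.2 ((hxneg hx).trans hlam.1)) hx.le
  · rw [hx, mul_zero]
  · exact mul_nonneg (sub_nonneg.2 (hlam.2.trans (hxpos hx))) hx.le

theorem ae_min_le_abs_sub (hc : c ≠ 0) (hneg : ∀ᵐ x ∂arc, trig c x < 0 → φ x ≤ m)
    (hpos : ∀ᵐ x ∂arc, 0 < trig c x → M ≤ φ x) :
    ∀ᵐ x ∂arc, min (lam - m) (M - lam) ≤ |φ x - lam| := by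
  filter_upwards [hneg, hpos, ae_trig_ne_zero hc] with x hxneg hxpos hx
  rcases lt_or_gt_of_ne hx with hx | hx
  · exact (min_le_left _ _).trans (by linarith [hxneg hx, neg_le_abs (φ x - lam)])
  · exact (min_le_right _ _).trans (by linarith [hxpos hx, le_abs_self (φ x - lam)])

theorem corollary3p2_general (hc : c ≠ 0) (hmM : m < M)
    (hneg : ∀ᵐ x ∂arc, trig c x < 0 → φ x ≤ m) (hpos : ∀ᵐ x ∂arc, 0 < trig c x → M ≤ φ x) :
    (∀ lam ∈ Set.Ioo m M,
      IsNeilEigenvalue φ lam ∧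
      ∃ f : L2,
        IsOuter f ∧
        (∀ᵐ x ∂arc, (φ x - lam) * ‖f x‖ ^ 2 = trig c x) ∧
        IsNeilEigenvector φ lam f ∧
        ∀ h : L2, IsOuter h → (∀ᵐ x ∂arc, (φ x - lam) * ‖h x‖ ^ 2 = trig c x) →
          ∃ u : ℂ, ‖u‖ = 1 ∧ h = u • f) ∧
    (IsNeilEigenvalue φ M ↔ QuotientMemL1 (trig c) (fun x => φ x - M)) ∧
    (IsNeilEigenvalue φ m ↔ QuotientMemL1 (trig c) (fun x => φ x - m)) := by
  have hsign {lam : ℝ} (hlam : lam ∈ Set.Icc m M) := ae_sub_mul_trig_nonneg hneg hpos hlam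
  refine ⟨fun lam hlam => ?_, ?_, ?_⟩
  · have hq : QuotientMemL1 (trig c) (fun x => φ x - lam) :=
      quotientMemL1_of_le_abs c (lt_min (sub_pos.2 hlam.1) (sub_pos.2 hlam.2))
        (ae_min_le_abs_sub hc hneg hpos)
    obtain ⟨f, hf, hfc⟩ :=
      exists_isOuter_of_quotientMemL1 hc (hsign (Set.Ioo_subset_Icc_self hlam)) hq
    have hev := isNeilEigenvector_of_isOuter hf hfc
    refine ⟨⟨f, hev⟩, f, hf, hfc, hev, fun h hh hhc => hf.eq_smul_of_mul_norm_sq_eq hh hq.1 ?_⟩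
    filter_upwards [hfc, hhc] with x hfx hhx using hfx.trans hhx.symm
  · refine isNeilEigenvalue_iff_quotientMemL1 hc (hsign ⟨hmM.le, le_rfl⟩) fun hM => ?_
    obtain ⟨x, hx, hxm, hxM⟩ := ((frequently_trig_neg hc).and_eventually (hneg.and hM)).exists
    linarith [hxm hx]
  · refine isNeilEigenvalue_iff_quotientMemL1 hc (hsign ⟨le_rfl, hmM.le⟩) fun hm => ?_
    obtain ⟨x, hx, hxM, hxm⟩ := ((frequently_trig_pos hc).and_eventually (hpos.and hm)).exists
    linarith [hxM hx]

end GapCondition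

end NeilToeplitz

end

theorem corollary3p2 (φ : NeilToeplitz.Symbol) (c : ℂ) (m M : ℝ)
    (hm : essSup (fun x => ((φ x : ℝ) : EReal))
      (NeilToeplitz.arc.restrict {x | NeilToeplitz.trig c x < 0}) = (m : EReal))
    (hm0 : m < 0) (hM0 : 0 < M)
    (hM : essInf (fun x => ((φ x : ℝ) : EReal))
      (NeilToeplitz.arc.restrict {x | 0 < NeilToeplitz.trig c x}) = (M : EReal)) :
    (∀ lam ∈ Set.Ioo m M,
      NeilToeplitz.IsNeilEigenvalue φ lam ∧
      ∃ f : NeilToeplitz.L2,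
        NeilToeplitz.IsOuter f ∧
        (∀ᵐ x ∂NeilToeplitz.arc, (φ x - lam) * ‖f x‖ ^ 2 = NeilToeplitz.trig c x) ∧
        NeilToeplitz.IsNeilEigenvector φ lam f ∧
        ∀ h : NeilToeplitz.L2, NeilToeplitz.IsOuter h →
          (∀ᵐ x ∂NeilToeplitz.arc, (φ x - lam) * ‖h x‖ ^ 2 = NeilToeplitz.trig c x) →
          ∃ u : ℂ, ‖u‖ = 1 ∧ h = u • f) ∧
    (NeilToeplitz.IsNeilEigenvalue φ M ↔
      NeilToeplitz.QuotientMemL1 (NeilToeplitz.trig c) (fun x => φ x - M)) ∧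
    (NeilToeplitz.IsNeilEigenvalue φ m ↔
      NeilToeplitz.QuotientMemL1 (NeilToeplitz.trig c) (fun x => φ x - m)) := by
  open NeilToeplitz in
  have hmeas : Measurable (trig c) := (continuous_trig c).measurable
  have hc : c ≠ 0 := by
    rintro rfl
    simp [trig_zero] at hm
  exact corollary3p2_general hc (hm0.trans hM0)
    (ae_le_of_essSup_restrict_eq (measurableSet_lt hmeas measurable_const) hm)
    (ae_le_of_essInf_restrict_eq (measurableSet_lt measurable_const hmeas) hM)
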